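/- Let $K$ be a commutative artinian ring and let $A$ be an artin $K$-algebra, i.e. a $K$-algebra that is finitely generated as a $K$-module. Let $\operatorname{mod} A$ be the category of finitely generated right $A$-modules, and let $(\mathcal{T},\mathcal{F})$ be a torsion pair of $\operatorname{mod} A$: $\mathcal{T}$ and $\mathcal{F}$ are full subcategories closed under isomorphisms, $\operatorname{Hom}_A(T,F)=0$ for all $T\in\mathcal{T}$ and $F\in\mathcal{F}$, and every $X\in\operatorname{mod} A$ fits in a short exact sequence $0\to tX\to X\to fX\to 0$ with $tX\in\mathcal{T}$ and $fX\in\mathcal{F}$. For $X\in\operatorname{mod} A$ and $n\ge 1$, the $n$-th syzygy $\Omega^n_X$ is the image of $P_n\to P_{n-1}$ in a minimal projective resolution $\cdots\to P_1\to P_0\to X\to 0$ in $\operatorname{mod} A$, and the $n$-th cosyzygy $\Omega^{-n}_X$ is the image of $I^{n-1}\to I^n$ in a minimal injective resolution $0\to X\to I^0\to I^1\to\cdots$ in $\operatorname{mod} A$; both are unique up to isomorphism. Put $\Omega^0_X=X$. Then for every integer $n\ge 0$ the following are equivalent: 1. $\operatorname{Ext}^{kn}_A(T,F)=0$ for all $k\ge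 1$, $T\in\mathcal{T}$ and $F\in\mathcal{F}$. 2. $\operatorname{Ext}^{n}_A(T,F)=0$ for all $T\in\mathcal{T}$ and $F\in\mathcal{F}$. 3. $\mathcal{T}$ is closed under $n$-th syzygies: if $X\in\mathcal{T}$, then $\Omega^n_X\in\mathcal{T}$. 4. $\mathcal{F}$ is closed under $n$-th cosyzygies: if $X\in\mathcal{F}$, then $\Omega^{-n}_X\in\mathcal{F}$. -/

import Mathlib

open CategoryTheory

universe u w

namespace OmegaTorsion

section

variable {R : Type u} [Ring R]

/-- A projective cover: a surjection from a projective module with superfluous kernel. -/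
structure IsProjectiveCover {P M : Type u} [AddCommGroup P] [Module R P]
    [AddCommGroup M] [Module R M] (p : P →ₗ[R] M) : Prop where
  projective : Module.Projective R P
  surjective : Function.Surjective p
  superfluous : ∀ N : Submodule R P, N ⊔ LinearMap.ker p = ⊤ → N = ⊤

/-- An injective envelope: an injection into an injective module with essential image. -/
structure IsInjectiveEnvelope {M I : Type u} [AddCommGroup M] [Module R M]
    [AddCommGroup I] [Module R I] (i : M →ₗ[R] I) : Prop where
  injective_module : Module.Injective R I
  injective : Function.Injective i
  essential : ∀ N : Submodule R I, N ⊓ LinearMap.range i = ⊥ → N = ⊥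

/-- A torsion pair `(T, F)` of the category of finitely generated modules, where `T` and `F` are
full subcategories closed under isomorphisms. -/
structure IsTorsionPair (T F : ObjectProperty (FGModuleCat.{u} R)) : Prop where
  isClosedUnderIso_left : T.IsClosedUnderIsomorphisms
  isClosedUnderIso_right : F.IsClosedUnderIsomorphisms
  hom_eq_zero : ∀ X Y : FGModuleCat.{u} R, T X → F Y → ∀ f : X →ₗ[R] Y, f = 0
  exists_exact : ∀ X : FGModuleCat.{u} R, ∃ (tX fX : FGModuleCat.{u} R)
    (i : tX →ₗ[R] X) (p : X →ₗ[R] fX), T tX ∧ F fX ∧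
      Function.Injective i ∧ Function.Exact i p ∧ Function.Surjective p

/-- A minimal projective resolution `⋯ → P 2 → P 1 → P 0 → X → 0` by finitely generated modules:
an exact sequence in which `P 0 → X` and every corestriction of `P (n + 1) → P n` to its image
(which is the preceding kernel, by exactness) is a projective cover. -/
structure MinimalProjectiveResolution (X : FGModuleCat.{u} R) where
  P : ℕ → FGModuleCat.{u} R
  d : ∀ n, P (n + 1) →ₗ[R] P n
  π : P 0 →ₗ[R] X
  exact_zero : Function.Exact (d 0) π
  exact_succ : ∀ n, Function.Exact (d (n + 1)) (d n)
  cover_zero : IsProjectiveCover π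
  cover_succ : ∀ n, IsProjectiveCover (d n).rangeRestrict

/-- The `n`-th syzygy computed by a minimal projective resolution of `X`: the image of
`P n → P (n - 1)` for `n ≥ 1`, and `X` itself for `n = 0`. -/
def MinimalProjectiveResolution.syzygy {X : FGModuleCat.{u} R}
    (Q : MinimalProjectiveResolution X) : ℕ → FGModuleCat.{u} R
  | 0 => X
  | n + 1 => FGModuleCat.of R (LinearMap.range (Q.d n))

/-- A minimal injective resolution `0 → X → I 0 → I 1 → I 2 → ⋯` by finitely generated modules:
an exact sequence in which `X → I 0` and every inclusion of the image of `I n → I (n + 1)`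
(which is the cokernel of the preceding map, by exactness) into `I (n + 1)` is an injective
envelope. -/
structure MinimalInjectiveResolution (X : FGModuleCat.{u} R) where
  I : ℕ → FGModuleCat.{u} R
  d : ∀ n, I n →ₗ[R] I (n + 1)
  ι : X →ₗ[R] I 0
  exact_zero : Function.Exact ι (d 0)
  exact_succ : ∀ n, Function.Exact (d n) (d (n + 1))
  envelope_zero : IsInjectiveEnvelope ι
  envelope_succ : ∀ n, IsInjectiveEnvelope (LinearMap.range (d n)).subtype

/-- The `n`-th cosyzygy computed by a minimal injective resolution of `X`: the image of
`I (n - 1) → I n` for `n ≥ 1`, and `X` itself for `n = 0`. -/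
def MinimalInjectiveResolution.cosyzygy {X : FGModuleCat.{u} R}
    (J : MinimalInjectiveResolution X) : ℕ → FGModuleCat.{u} R
  | 0 => X
  | n + 1 => FGModuleCat.of R (LinearMap.range (J.d n))

/-- `Ext^n(T, F) = 0`: the groups `Ext^n(X, Y)` of `R`-modules vanish for `X` in `T`, `Y` in `F`. -/
def ExtVanishes (T F : ObjectProperty (FGModuleCat.{u} R)) (n : ℕ) : Prop :=
  ∀ X Y : FGModuleCat.{u} R, T X → F Y → Subsingleton (Abelian.Ext.{u} X.obj Y.obj n)

/-- `T` is closed under `n`-th syzygies. The `n`-th syzygy is unique up to isomorphism, so that the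
choice of the minimal projective resolution is immaterial. -/
def ClosedUnderSyzygies (T : ObjectProperty (FGModuleCat.{u} R)) (n : ℕ) : Prop :=
  ∀ X : FGModuleCat.{u} R, T X → ∀ Q : MinimalProjectiveResolution X, T (Q.syzygy n)

/-- `F` is closed under `n`-th cosyzygies. The `n`-th cosyzygy is unique up to isomorphism, so that
the choice of the minimal injective resolution is immaterial. -/
def ClosedUnderCosyzygies (F : ObjectProperty (FGModuleCat.{u} R)) (n : ℕ) : Prop :=
  ∀ X : FGModuleCat.{u} R, F X → ∀ J : MinimalInjectiveResolution X, F (J.cosyzygy n)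

end

end OmegaTorsion

/-! Dimension shifting reduces `Ext^n` (`n ≥ 1`) to `Ext^1` of an `(n-1)`-st syzygy; minimality then
turns vanishing of `Ext^1` into vanishing of Hom. For 2 → 3, let `f : Ω^n X → Y` with `Y` in `F`.
Its image `Y'` lies in `F`, so `Ext^n(X, Y') = 0` and `f` extends to `g : P → Y'` on the last
projective `P`. As `f` is onto `Y'`, `P = ker g + Ω^n X`; but `Ω^n X` is superfluous in `P`, so `g =
0` and `f = 0`. Hence `Ω^n X` is in `T`. Dually, 2 → 4 uses essential extensions. Conversely, Hom
vanishes between `T` and `F`, and each shift by `n` stays inside `T` (3 → 1) or `F` (4 → 2). Since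
closure quantifies over all minimal resolutions, these two directions need one to exist. -/

namespace OmegaTorsion

/-! ### Projective covers and finitely generated injective envelopes -/

section Covers

variable {R : Type u} [Ring R]

/-- Take `C` minimal in `R^n` with `C + ker f = R^n`; minimality makes the kernel on `C`
superfluous. Lifting `f` to `h : R^n → C` gives an automorphism of `C`, so `C` is a direct summand.
-/
theorem exists_isProjectiveCover [IsArtinianRing R] (M : FGModuleCat.{u} R) :
    ∃ (P : FGModuleCat.{u} R) (p : P →ₗ[R] M), IsProjectiveCover p := by
  obtain ⟨n, f, hf⟩ := Module.Finite.exists_fin' R M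
  obtain ⟨C, hC, hmin⟩ := IsArtinian.set_has_minimal
    {C : Submodule R (Fin n → R) | C ⊔ LinearMap.ker f = ⊤} ⟨⊤, top_sup_eq _⟩
  let p : C →ₗ[R] M := f ∘ₗ C.subtype
  have hp : Function.Surjective p := fun m ↦ by
    obtain ⟨x, rfl⟩ := hf m
    have hx : x ∈ C ⊔ LinearMap.ker f := by rw [show C ⊔ LinearMap.ker f = ⊤ from hC]; trivial
    obtain ⟨c, hc, k, hk, rfl⟩ := Submodule.mem_sup.1 hx
    exact ⟨⟨c, hc⟩, by simp [p, LinearMap.mem_ker.1 hk]⟩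
  have hs : ∀ N : Submodule R C, N ⊔ LinearMap.ker p = ⊤ → N = ⊤ := fun N hN ↦ by
    have hN' : N.map C.subtype ⊔ LinearMap.ker f = ⊤ := by
      rw [eq_top_iff, ← show C ⊔ LinearMap.ker f = ⊤ from hC]
      refine sup_le (fun c hc ↦ ?_) le_sup_right
      have hx : (⟨c, hc⟩ : C) ∈ N ⊔ LinearMap.ker p := by rw [hN]; trivial
      obtain ⟨y, hy, k, hk, hyk⟩ := Submodule.mem_sup.1 hx
      exact Submodule.mem_sup.2 ⟨y, Submodule.mem_map_of_mem hy, k, hk, congrArg Subtype.val hyk⟩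
    have hle : N.map C.subtype ≤ C := Submodule.map_subtype_le C N
    have heq : N.map C.subtype = C := eq_of_le_of_not_lt hle (hmin _ hN')
    refine Submodule.map_injective_of_injective C.injective_subtype ?_
    rw [heq, Submodule.map_subtype_top]
  obtain ⟨h, hh⟩ := Module.projective_lifting_property p f hp
  have hsurj : Function.Surjective (h ∘ₗ C.subtype) := by
    rw [← LinearMap.range_eq_top]
    refine hs _ (eq_top_iff.2 fun c _ ↦ Submodule.mem_sup.2
      ⟨h c, ⟨c, rfl⟩, c - h c, ?_, by simp⟩)
    have : p (h c) = f c := LinearMap.congr_fun hh c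
    change f (c - h c) = 0
    rw [map_sub, ← this]
    exact sub_self _
  have hinj := IsNoetherian.injective_of_surjective_endomorphism _ hsurj
  let e := LinearEquiv.ofBijective _ ⟨hinj, hsurj⟩
  have hproj : Module.Projective R C :=
    Module.Projective.of_split (C.subtype ∘ₗ e.symm.toLinearMap) h
      (LinearMap.ext fun c ↦ e.apply_symm_apply c)
  exact ⟨FGModuleCat.of R C, p, hproj, hp, hs⟩

/-- An essential extension of a finitely generated module over an artin algebra is finitely
generated. -/
theorem finite_of_essential (K : Type w) [CommRing K] [IsArtinianRing K] [Algebra K R]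
    [Module.Finite K R] {E : Type u} [AddCommGroup E] [Module R E] (X : Submodule R E)
    (hX : X.FG) (h : ∀ N : Submodule R E, N ⊓ X = ⊥ → N = ⊥) : Module.Finite R E := by
  let _ : Module K E := Module.compHom E (algebraMap K R)
  have : IsScalarTower K R E := ⟨fun k r x ↦ by
    rw [Algebra.smul_def, mul_smul]; rfl⟩
  have : IsArtinianRing R := IsArtinianRing.of_finite K R
  have : SMulCommClass R K E := IsScalarTower.to_smulCommClass'
  let J := Ring.jacobson R
  -- The annihilators of `J ^ i` in `E` exhaust `E` because `J` is nilpotent; each is shown to be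
  -- noetherian over `K`.
  let W (i : ℕ) : Submodule K E :=
    { carrier := {x | ∀ a ∈ J ^ i, a • x = 0}
      add_mem' := fun hx hy a ha ↦ by rw [smul_add, hx a ha, hy a ha, add_zero]
      zero_mem' := fun a _ ↦ smul_zero a
      smul_mem' := fun k x hx a ha ↦ by rw [smul_comm, hx a ha, smul_zero] }
  let S : Submodule R E :=
    { carrier := {x | ∀ a ∈ J, a • x = 0}
      add_mem' := fun hx hy a ha ↦ by rw [smul_add, hx a ha, hy a ha, add_zero]
      zero_mem' := fun a _ ↦ smul_zero a
      smul_mem' := fun r x hx a ha ↦ by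
        rw [← mul_smul]; exact hx _ (Ideal.mul_mem_right _ _ ha) }
  -- `S` is semisimple, being a module over `R / J`. A complement of `S ∩ X` in `S` meets `X`
  -- trivially, so it is zero.
  have hSX : S ≤ X := by
    have ht : Module.IsTorsionBySet R S (J : Set R) := fun x a ↦ Subtype.ext (x.2 a a.2)
    let _ := ht.module
    have hss : IsSemisimpleModule R S :=
      (ht.semilinearMap.isSemisimpleModule_iff_of_bijective Function.bijective_id).2 inferInstance
    obtain ⟨C, hC⟩ := exists_isCompl (X.comap S.subtype)
    have hC0 : C.map S.subtype = ⊥ := h _ <| by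
      rw [eq_bot_iff]
      rintro _ ⟨⟨c, hc, rfl⟩, hcX⟩
      have : c ∈ X.comap S.subtype ⊓ C := ⟨hcX, hc⟩
      rw [hC.inf_eq_bot] at this
      simpa using this
    have hC1 : C = ⊥ := Submodule.map_injective_of_injective S.injective_subtype (hC0.trans (Submodule.map_bot _).symm)
    have := hC.sup_eq_top
    rw [hC1, sup_bot_eq] at this
    intro x hx
    have hm : (⟨x, hx⟩ : S) ∈ X.comap S.subtype := by rw [this]; trivial
    exact hm
  have : Module.Finite R X := Module.Finite.iff_fg.2 hX
  have : Module.Finite K X := Module.Finite.trans R X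
  have : IsNoetherian K (X.restrictScalars K) := inferInstanceAs (IsNoetherian K X)
  have hS : IsNoetherian K (S.restrictScalars K) :=
    isNoetherian_of_le (show S.restrictScalars K ≤ X.restrictScalars K from hSX)
  obtain ⟨s, hs⟩ := (IsNoetherian.noetherian (J.restrictScalars K) : (J.restrictScalars K).FG)
  have hW (i : ℕ) : IsNoetherian K (W i) := by
    induction i with
    | zero =>
      have : W 0 = ⊥ := (eq_bot_iff).2 fun x hx ↦ by
        have h1 : (1 : R) ∈ J ^ 0 := by rw [J.pow_zero, Ideal.one_eq_top]; trivial
        simpa using hx 1 h1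
      rw [this]; infer_instance
    | succ i ih =>
      -- Multiplication by the finitely many `K`-generators of `J`; the kernel lies in `S`. These
      -- maps are `K`-linear but in general not `R`-linear, hence the use of `K`.
      let g : W (i + 1) →ₗ[K] (s → W i) := LinearMap.pi fun a ↦
        { toFun := fun x ↦ ⟨(a : R) • (x : E), fun b hb ↦ by
            rw [← mul_smul]
            refine x.2 _ ?_
            rw [J.pow_succ]
            refine Ideal.mul_mem_mul hb ?_
            have : (a : R) ∈ J.restrictScalars K := hs ▸ Submodule.subset_span a.2
            exact this⟩
          map_add' := fun x y ↦ Subtype.ext (smul_add _ _ _)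
          map_smul' := fun k x ↦ Subtype.ext (smul_comm _ _ _) }
      have hker : (LinearMap.ker g).map (W (i + 1)).subtype ≤ S.restrictScalars K := by
        rintro _ ⟨x, hx, rfl⟩ a ha
        have ha' : a ∈ Submodule.span K (s : Set R) := hs ▸ ha
        induction ha' using Submodule.span_induction with
        | mem a ha' => exact congrArg Subtype.val (congrFun (LinearMap.mem_ker.1 hx) ⟨a, ha'⟩)
        | zero => exact zero_smul _ _
        | add a b has hbs iha ihb =>
          rw [add_smul, iha (hs.le has), ihb (hs.le hbs), add_zero]
        | smul k a has iha => rw [smul_assoc, iha (hs.le has), smul_zero]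
      have hk : IsNoetherian K (LinearMap.ker g) := by
        have := isNoetherian_of_le hker
        exact isNoetherian_of_linearEquiv
          (Submodule.equivMapOfInjective _ (W (i + 1)).injective_subtype (LinearMap.ker g)).symm
      exact isNoetherian_of_range_eq_ker (LinearMap.ker g).subtype g (by simp)
  obtain ⟨n, hn⟩ := IsSemiprimaryRing.isNilpotent (R := R)
  have htop : W n = ⊤ := eq_top_iff.2 fun x _ a ha ↦ by
    have : a ∈ Ring.jacobson R ^ n := ha
    rw [hn] at this
    rw [show a = 0 from this, zero_smul]
  have hE : IsNoetherian K E := by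
    have := hW n
    rw [htop] at this
    exact isNoetherian_of_linearEquiv (Submodule.topEquiv : (⊤ : Submodule K E) ≃ₗ[K] E)
  exact Module.Finite.of_restrictScalars_finite K R E

/-- For `C` maximal among submodules of an injective `Q ⊇ M` meeting `M` trivially, `Q / C` is
essential over `M`, hence finitely generated. Extending `M → Q` to `Q / C` then exhibits `Q / C` as
a retract of `Q`. -/
theorem exists_isInjectiveEnvelope (K : Type w) [CommRing K] [IsArtinianRing K] [Algebra K R]
    [Module.Finite K R] (M : FGModuleCat.{u} R) :
    ∃ (I : FGModuleCat.{u} R) (i : M →ₗ[R] I), IsInjectiveEnvelope i := by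
  have : IsArtinianRing R := IsArtinianRing.of_finite K R
  let Q : ModuleCat.{u} R := Injective.under M.obj
  let f : M →ₗ[R] Q := (Injective.ι M.obj).hom
  have hf : Function.Injective f := (ModuleCat.mono_iff_injective (Injective.ι M.obj)).1 inferInstance
  have hQ : Module.Injective R Q := (Module.injective_iff_injective_object R Q).2
    (inferInstanceAs (Injective (Injective.under M.obj)))
  obtain ⟨C, hC⟩ := zorn_le_nonempty₀ {C : Submodule R Q | Disjoint (LinearMap.range f) C}
    (fun c hc hchain y hy ↦ ⟨sSup c, by
      refine (DirectedOn.disjoint_sSup_right hchain.directedOn).2 fun b hb ↦ hc hb,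
      fun z hz ↦ le_sSup hz⟩) ⊥ disjoint_bot_right
  let i : M →ₗ[R] Q ⧸ C := C.mkQ ∘ₗ f
  have hi : Function.Injective i := by
    rw [injective_iff_map_eq_zero]
    intro x hx
    have hx' : f x ∈ C := (Submodule.Quotient.mk_eq_zero C).1 hx
    exact (injective_iff_map_eq_zero f).1 hf x
      (Submodule.disjoint_def.1 hC.2.1 _ ⟨x, rfl⟩ hx')
  have hess : ∀ N : Submodule R (Q ⧸ C), N ⊓ LinearMap.range i = ⊥ → N = ⊥ := fun N hN ↦ by
    have hle : C ≤ N.comap C.mkQ := fun c hc ↦ by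
      simp [(Submodule.Quotient.mk_eq_zero C).2 hc]
    have hdis : Disjoint (LinearMap.range f) (N.comap C.mkQ) := by
      rw [Submodule.disjoint_def]
      rintro _ ⟨x, rfl⟩ hx
      have : i x ∈ N ⊓ LinearMap.range i := ⟨hx, x, rfl⟩
      rw [hN] at this
      rw [(injective_iff_map_eq_zero i).1 hi x this, map_zero]
    have := hC.2.2 hdis hle
    rw [eq_bot_iff]
    intro y hy
    obtain ⟨x, rfl⟩ := C.mkQ_surjective y
    exact (Submodule.Quotient.mk_eq_zero C).2 (this hy)
  have hinj {L : Type u} [AddCommGroup L] [Module R L] (g : Q ⧸ C →ₗ[R] L)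
      (hg : Function.Injective (g ∘ₗ i)) : Function.Injective g := by
    rw [← LinearMap.ker_eq_bot]
    refine hess _ (eq_bot_iff.2 ?_)
    rintro _ ⟨hx, x, rfl⟩
    have : x = 0 := (injective_iff_map_eq_zero _).1 hg x hx
    simp [this]
  have hfin : Module.Finite R (Q ⧸ C) :=
    finite_of_essential K (LinearMap.range i) (Module.Finite.iff_fg.1 inferInstance) hess
  obtain ⟨h, hh⟩ := hQ.out i hi f
  have hend : Function.Injective (C.mkQ ∘ₗ h) := hinj _ <| by
    have : (C.mkQ ∘ₗ h) ∘ₗ i = i := LinearMap.ext fun x ↦ congrArg C.mkQ (hh x)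
    rwa [this]
  let e := LinearEquiv.ofBijective _
    ⟨hend, IsArtinian.surjective_of_injective_endomorphism _ hend⟩
  have hI : Module.Injective R (Q ⧸ C) := ⟨fun X Y _ _ _ _ a ha b ↦ by
    obtain ⟨c, hc⟩ := hQ.out a ha (h ∘ₗ b)
    refine ⟨e.symm.toLinearMap ∘ₗ C.mkQ ∘ₗ c, fun x ↦ ?_⟩
    have : C.mkQ (c (a x)) = e (b x) := congrArg C.mkQ (hc x)
    simp [this]⟩
  exact ⟨FGModuleCat.of R (Q ⧸ C), i, hI, hi, hess⟩

end Covers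
-- Dimension shifting in an abelian category
section DimensionShift

open Abelian

variable {C : Type*} [Category* C] [Abelian C] [HasExt.{w} C] {S : ShortComplex C}

theorem subsingleton_ext_X₃_of_projective (hS : S.ShortExact) [Projective S.X₂] {Y : C} {m : ℕ}
    (h : Subsingleton (Ext.{w} S.X₁ Y m)) : Subsingleton (Ext.{w} S.X₃ Y (m + 1)) := by
  refine subsingleton_of_forall_eq 0 fun x ↦ ?_
  obtain ⟨y, rfl⟩ := Ext.contravariant_sequence_exact₃ hS Y x (Ext.eq_zero_of_projective _)
    (add_comm 1 m)
  rw [Subsingleton.elim y 0, Ext.comp_zero]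

/-- The target degree must be positive, since Hom out of a projective need not vanish. In degree
zero only extension of maps survives. -/
theorem subsingleton_ext_X₁_of_projective (hS : S.ShortExact) [Projective S.X₂] {Y : C} {m : ℕ}
    (h : Subsingleton (Ext.{w} S.X₃ Y (m + 2))) : Subsingleton (Ext.{w} S.X₁ Y (m + 1)) := by
  refine subsingleton_of_forall_eq 0 fun x ↦ ?_
  obtain ⟨y, rfl⟩ := Ext.contravariant_sequence_exact₁ hS Y x (add_comm 1 (m + 1))
    (Subsingleton.elim (α := Ext.{w} S.X₃ Y (m + 2)) _ _)
  rw [Ext.eq_zero_of_projective y, Ext.comp_zero]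

theorem exists_f_comp_eq_of_subsingleton_ext (hS : S.ShortExact) {Y : C}
    (h : Subsingleton (Ext.{w} S.X₃ Y 1)) (f : S.X₁ ⟶ Y) : ∃ g : S.X₂ ⟶ Y, S.f ≫ g = f := by
  obtain ⟨y, hy⟩ := Ext.contravariant_sequence_exact₁ hS Y (Ext.mk₀ f) (add_comm 1 0)
    (Subsingleton.elim (α := Ext.{w} S.X₃ Y 1) _ _)
  obtain ⟨g, rfl⟩ := (Ext.mk₀_bijective _ _).2 y
  exact ⟨g, (Ext.mk₀_bijective _ _).1 (by rw [← hy, Ext.mk₀_comp_mk₀])⟩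

theorem subsingleton_ext_X₁_of_injective (hS : S.ShortExact) [Injective S.X₂] {X : C} {m : ℕ}
    (h : Subsingleton (Ext.{w} X S.X₃ m)) : Subsingleton (Ext.{w} X S.X₁ (m + 1)) := by
  refine subsingleton_of_forall_eq 0 fun x ↦ ?_
  obtain ⟨y, rfl⟩ := Ext.covariant_sequence_exact₁ X hS x (Ext.eq_zero_of_injective _) rfl
  rw [Subsingleton.elim y 0, Ext.zero_comp]

theorem subsingleton_ext_X₃_of_injective (hS : S.ShortExact) [Injective S.X₂] {X : C} {m : ℕ}
    (h : Subsingleton (Ext.{w} X S.X₁ (m + 2))) : Subsingleton (Ext.{w} X S.X₃ (m + 1)) := by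
  refine subsingleton_of_forall_eq 0 fun x ↦ ?_
  obtain ⟨y, rfl⟩ := Ext.covariant_sequence_exact₃ X hS x rfl
    (Subsingleton.elim (α := Ext.{w} X S.X₁ (m + 2)) _ _)
  rw [Ext.eq_zero_of_injective y, Ext.zero_comp]

theorem exists_comp_g_eq_of_subsingleton_ext (hS : S.ShortExact) {X : C}
    (h : Subsingleton (Ext.{w} X S.X₁ 1)) (f : X ⟶ S.X₃) : ∃ g : X ⟶ S.X₂, g ≫ S.g = f := by
  obtain ⟨y, hy⟩ := Ext.covariant_sequence_exact₃ X hS (Ext.mk₀ f) (zero_add 1)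
    (Subsingleton.elim (α := Ext.{w} X S.X₁ 1) _ _)
  obtain ⟨g, rfl⟩ := (Ext.mk₀_bijective _ _).2 y
  exact ⟨g, (Ext.mk₀_bijective _ _).1 (by rw [← hy, Ext.mk₀_comp_mk₀])⟩

end DimensionShift

section ShortExact

variable {R : Type u} [Ring R] {L M N : FGModuleCat.{u} R} {i : L →ₗ[R] M} {p : M →ₗ[R] N}

/-- A short exact sequence of finitely generated modules, as a short complex of modules. -/
abbrev shortComplexOfExact (h : Function.Exact i p) : ShortComplex (ModuleCat.{u} R) :=
  ModuleCat.shortComplexOfCompEqZero i p h.linearMap_comp_eq_zero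

theorem shortExact_shortComplexOfExact (h : Function.Exact i p) (hi : Function.Injective i)
    (hp : Function.Surjective p) : (shortComplexOfExact h).ShortExact :=
  ModuleCat.shortComplex_shortExact _ h hi hp

end ShortExact

/-! ### Existence of minimal resolutions -/

section Resolutions

variable {R : Type u} [Ring R]

theorem exact_subtype_range {L M N : Type*} [AddCommGroup L] [Module R L] [AddCommGroup M]
    [Module R M] [AddCommGroup N] [Module R N] {f : L →ₗ[R] M} {g : M →ₗ[R] N}
    (h : Function.Exact f g) : Function.Exact (LinearMap.range f).subtype g :=
  LinearMap.exact_iff.2 (by rw [Submodule.range_subtype]; exact LinearMap.exact_iff.1 h)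

theorem exact_rangeRestrict {L M N : Type*} [AddCommGroup L] [Module R L] [AddCommGroup M]
    [Module R M] [AddCommGroup N] [Module R N] {f : L →ₗ[R] M} {g : M →ₗ[R] N}
    (h : Function.Exact f g) : Function.Exact f g.rangeRestrict :=
  LinearMap.exact_iff.2 (by rw [LinearMap.ker_rangeRestrict]; exact LinearMap.exact_iff.1 h)

theorem MinimalProjectiveResolution.exists_exact {X : FGModuleCat.{u} R}
    (Q : MinimalProjectiveResolution X) :
    ∀ n, ∃ (i : Q.syzygy (n + 1) →ₗ[R] Q.P n) (p : Q.P n →ₗ[R] Q.syzygy n),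
      Function.Injective i ∧ Function.Exact i p ∧ IsProjectiveCover p
  | 0 => ⟨(LinearMap.range (Q.d 0)).subtype, Q.π, Submodule.injective_subtype _,
      exact_subtype_range Q.exact_zero, Q.cover_zero⟩
  | n + 1 => ⟨(LinearMap.range (Q.d (n + 1))).subtype, (Q.d n).rangeRestrict,
      Submodule.injective_subtype _, exact_subtype_range (exact_rangeRestrict (Q.exact_succ n)),
      Q.cover_succ n⟩

theorem MinimalInjectiveResolution.exists_exact {X : FGModuleCat.{u} R}
    (J : MinimalInjectiveResolution X) :
    ∀ n, ∃ (i : J.cosyzygy n →ₗ[R] J.I n) (p : J.I n →ₗ[R] J.cosyzygy (n + 1)),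
      IsInjectiveEnvelope i ∧ Function.Exact i p ∧ Function.Surjective p
  | 0 => ⟨J.ι, (J.d 0).rangeRestrict, J.envelope_zero, exact_rangeRestrict J.exact_zero,
      LinearMap.surjective_rangeRestrict _⟩
  | n + 1 => ⟨(LinearMap.range (J.d n)).subtype, (J.d (n + 1)).rangeRestrict, J.envelope_succ n,
      exact_subtype_range (exact_rangeRestrict (J.exact_succ n)),
      LinearMap.surjective_rangeRestrict _⟩

theorem IsProjectiveCover.rangeRestrict {P M N : FGModuleCat.{u} R} {p : P →ₗ[R] M}
    (hp : IsProjectiveCover p) {f : M →ₗ[R] N} (hf : Function.Injective f) :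
    IsProjectiveCover (f ∘ₗ p).rangeRestrict where
  projective := hp.projective
  surjective := LinearMap.surjective_rangeRestrict _
  superfluous N hN := hp.superfluous N <| by
    rwa [LinearMap.ker_rangeRestrict, LinearMap.ker_comp_of_ker_eq_bot _
      (LinearMap.ker_eq_bot.2 hf)] at hN

theorem nonempty_minimalProjectiveResolution [IsArtinianRing R] (X : FGModuleCat.{u} R) :
    Nonempty (MinimalProjectiveResolution X) := by
  choose P p hp using exists_isProjectiveCover (R := R)
  let Ω : ℕ → FGModuleCat.{u} R := fun n ↦
    Nat.rec X (fun _ M ↦ FGModuleCat.of R (LinearMap.ker (p M))) n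
  have hrange (n : ℕ) : LinearMap.range
      ((LinearMap.ker (p (Ω n))).subtype ∘ₗ p (Ω (n + 1))) = LinearMap.ker (p (Ω n)) := by
    rw [LinearMap.range_comp_of_range_eq_top _ (LinearMap.range_eq_top.2 (hp (Ω (n + 1))).surjective),
      Submodule.range_subtype]
  have hker (n : ℕ) : LinearMap.ker
      ((LinearMap.ker (p (Ω n))).subtype ∘ₗ p (Ω (n + 1))) = LinearMap.ker (p (Ω (n + 1))) :=
    LinearMap.ker_comp_of_ker_eq_bot _ (Submodule.ker_subtype _)
  exact ⟨{
    P := fun n ↦ P (Ω n)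
    d := fun n ↦ (LinearMap.ker (p (Ω n))).subtype ∘ₗ p (Ω (n + 1))
    π := p X
    exact_zero := LinearMap.exact_iff.2 (hrange 0).symm
    exact_succ := fun n ↦ LinearMap.exact_iff.2 ((hker n).trans (hrange (n + 1)).symm)
    cover_zero := hp X
    cover_succ := fun n ↦ (hp (Ω (n + 1))).rangeRestrict (Submodule.injective_subtype _) }⟩

theorem IsInjectiveEnvelope.subtype_range {M I N : FGModuleCat.{u} R} {i : M →ₗ[R] I}
    (hi : IsInjectiveEnvelope i) {f : N →ₗ[R] M} (hf : Function.Surjective f) :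
    IsInjectiveEnvelope (LinearMap.range (i ∘ₗ f)).subtype where
  injective_module := hi.injective_module
  injective := Submodule.injective_subtype _
  essential N hN := hi.essential N <| by
    rwa [Submodule.range_subtype, LinearMap.range_comp_of_range_eq_top _
      (LinearMap.range_eq_top.2 hf)] at hN

theorem nonempty_minimalInjectiveResolution (K : Type w) [CommRing K] [IsArtinianRing K]
    [Algebra K R] [Module.Finite K R] (X : FGModuleCat.{u} R) :
    Nonempty (MinimalInjectiveResolution X) := by
  choose I i hi using exists_isInjectiveEnvelope (R := R) K
  let Ω : ℕ → FGModuleCat.{u} R := fun n ↦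
    Nat.rec X (fun _ M ↦ FGModuleCat.of R (I M ⧸ LinearMap.range (i M))) n
  have hrange (n : ℕ) : LinearMap.range (i (Ω (n + 1)) ∘ₗ (LinearMap.range (i (Ω n))).mkQ) =
      LinearMap.range (i (Ω (n + 1))) :=
    LinearMap.range_comp_of_range_eq_top _ (Submodule.range_mkQ _)
  have hker (n : ℕ) : LinearMap.ker (i (Ω (n + 1)) ∘ₗ (LinearMap.range (i (Ω n))).mkQ) =
      LinearMap.range (i (Ω n)) := by
    rw [LinearMap.ker_comp_of_ker_eq_bot _ (LinearMap.ker_eq_bot.2 (hi (Ω (n + 1))).injective),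
      Submodule.ker_mkQ]
  exact ⟨{
    I := fun n ↦ I (Ω n)
    d := fun n ↦ i (Ω (n + 1)) ∘ₗ (LinearMap.range (i (Ω n))).mkQ
    ι := i X
    exact_zero := LinearMap.exact_iff.2 (hker 0)
    exact_succ := fun n ↦ LinearMap.exact_iff.2 ((hker (n + 1)).trans (hrange n).symm)
    envelope_zero := hi X
    envelope_succ := fun n ↦ (hi (Ω (n + 1))).subtype_range (Submodule.mkQ_surjective _) }⟩

end Resolutions

/-! ### Shifting along a whole resolution -/

section Shift

open Abelian

variable {R : Type u} [Ring R] {X Y : FGModuleCat.{u} R}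

theorem MinimalProjectiveResolution.exists_shortExact (Q : MinimalProjectiveResolution X) (n : ℕ) :
    ∃ (i : Q.syzygy (n + 1) →ₗ[R] Q.P n) (p : Q.P n →ₗ[R] Q.syzygy n) (h : Function.Exact i p),
      IsProjectiveCover p ∧ (shortComplexOfExact h).ShortExact ∧
        Projective (shortComplexOfExact h).X₂ := by
  obtain ⟨i, p, hi, h, hp⟩ := Q.exists_exact n
  have := hp.projective
  exact ⟨i, p, h, hp, shortExact_shortComplexOfExact h hi hp.surjective,
    ModuleCat.projective_of_categoryTheory_projective (P := (Q.P n).obj)⟩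

theorem MinimalInjectiveResolution.exists_shortExact (J : MinimalInjectiveResolution X) (n : ℕ) :
    ∃ (i : J.cosyzygy n →ₗ[R] J.I n) (p : J.I n →ₗ[R] J.cosyzygy (n + 1))
      (h : Function.Exact i p), IsInjectiveEnvelope i ∧ (shortComplexOfExact h).ShortExact ∧
        Injective (shortComplexOfExact h).X₂ := by
  obtain ⟨i, p, hi, h, hp⟩ := J.exists_exact n
  exact ⟨i, p, h, hi, shortExact_shortComplexOfExact h hi.injective hp,
    (Module.injective_iff_injective_object R (J.I n)).1 hi.injective_module⟩

theorem MinimalProjectiveResolution.subsingleton_ext_of_syzygy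
    (Q : MinimalProjectiveResolution X) (n : ℕ) {m : ℕ}
    (h : Subsingleton (Ext.{u} (Q.syzygy n).obj Y.obj m)) :
    Subsingleton (Ext.{u} X.obj Y.obj (n + m)) := by
  induction n generalizing m with
  | zero => rwa [Nat.zero_add]
  | succ n ih =>
    obtain ⟨i, p, hip, -, hS, _⟩ := Q.exists_shortExact n
    rw [Nat.add_right_comm]
    exact ih (subsingleton_ext_X₃_of_projective hS h)

theorem MinimalProjectiveResolution.subsingleton_ext_syzygy
    (Q : MinimalProjectiveResolution X) (n : ℕ) {m : ℕ}
    (h : Subsingleton (Ext.{u} X.obj Y.obj (n + m + 1))) :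
    Subsingleton (Ext.{u} (Q.syzygy n).obj Y.obj (m + 1)) := by
  induction n generalizing m with
  | zero => rwa [Nat.zero_add] at h
  | succ n ih =>
    obtain ⟨i, p, hip, -, hS, _⟩ := Q.exists_shortExact n
    rw [Nat.add_right_comm n 1 m] at h
    exact subsingleton_ext_X₁_of_projective hS (ih h)

theorem MinimalInjectiveResolution.subsingleton_ext_of_cosyzygy
    (J : MinimalInjectiveResolution Y) (n : ℕ) {m : ℕ}
    (h : Subsingleton (Ext.{u} X.obj (J.cosyzygy n).obj m)) :
    Subsingleton (Ext.{u} X.obj Y.obj (n + m)) := by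
  induction n generalizing m with
  | zero => rwa [Nat.zero_add]
  | succ n ih =>
    obtain ⟨i, p, hip, -, hS, _⟩ := J.exists_shortExact n
    rw [Nat.add_right_comm]
    exact ih (subsingleton_ext_X₁_of_injective hS h)

theorem MinimalInjectiveResolution.subsingleton_ext_cosyzygy
    (J : MinimalInjectiveResolution Y) (n : ℕ) {m : ℕ}
    (h : Subsingleton (Ext.{u} X.obj Y.obj (n + m + 1))) :
    Subsingleton (Ext.{u} X.obj (J.cosyzygy n).obj (m + 1)) := by
  induction n generalizing m with
  | zero => rwa [Nat.zero_add] at h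
  | succ n ih =>
    obtain ⟨i, p, hip, -, hS, _⟩ := J.exists_shortExact n
    rw [Nat.add_right_comm n 1 m] at h
    exact subsingleton_ext_X₃_of_injective hS (ih h)

theorem subsingleton_ext_zero (h : ∀ f : X →ₗ[R] Y, f = 0) :
    Subsingleton (Ext.{u} X.obj Y.obj 0) := by
  refine subsingleton_of_forall_eq 0 fun x ↦ ?_
  obtain ⟨f, rfl⟩ := (Ext.mk₀_bijective _ _).2 x
  rw [show f = 0 from ModuleCat.hom_ext (h f.hom), Ext.mk₀_zero]

end Shift

/-! ### Torsion pairs and the implications -/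

section TorsionPair

variable {R : Type u} [Ring R] {T F : ObjectProperty (FGModuleCat.{u} R)}

namespace IsTorsionPair

/-- The projection `X → fX` vanishes, so `tX → X` is an isomorphism. -/
theorem mem_left (hTF : IsTorsionPair T F) {X : FGModuleCat.{u} R}
    (h : ∀ Y : FGModuleCat.{u} R, F Y → ∀ f : X →ₗ[R] Y, f = 0) : T X := by
  have := hTF.isClosedUnderIso_left
  obtain ⟨A, B, i, p, hA, hB, hi, hip, -⟩ := hTF.exists_exact X
  have hs : Function.Surjective i := fun x ↦ (hip x).1 (by rw [h B hB p]; rfl)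
  exact T.prop_of_iso (LinearEquiv.ofBijective i ⟨hi, hs⟩).toFGModuleCatIso hA

theorem mem_right (hTF : IsTorsionPair T F) {Y : FGModuleCat.{u} R}
    (h : ∀ X : FGModuleCat.{u} R, T X → ∀ f : X →ₗ[R] Y, f = 0) : F Y := by
  have := hTF.isClosedUnderIso_right
  obtain ⟨A, B, i, p, hA, hB, -, hip, hp⟩ := hTF.exists_exact Y
  have hi : Function.Injective p := (injective_iff_map_eq_zero p).2 fun x hx ↦ by
    obtain ⟨a, rfl⟩ := (hip x).1 hx
    rw [h A hA i]; rfl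
  exact F.prop_of_iso (LinearEquiv.ofBijective p ⟨hi, hp⟩).symm.toFGModuleCatIso hB

theorem mem_left_of_surjective (hTF : IsTorsionPair T F) {X X' : FGModuleCat.{u} R} (hX : T X)
    (p : X →ₗ[R] X') (hp : Function.Surjective p) : T X' :=
  hTF.mem_left fun Y hY f ↦ LinearMap.cancel_right hp |>.1 <| by
    rw [hTF.hom_eq_zero X Y hX hY (f ∘ₗ p), LinearMap.zero_comp]

theorem mem_right_of_injective (hTF : IsTorsionPair T F) {Y Y' : FGModuleCat.{u} R} (hY : F Y)
    (i : Y' →ₗ[R] Y) (hi : Function.Injective i) : F Y' :=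
  hTF.mem_right fun X hX f ↦ LinearMap.cancel_left hi |>.1 <| by
    rw [hTF.hom_eq_zero X Y hX hY (i ∘ₗ f), LinearMap.comp_zero]

theorem extVanishes_zero (hTF : IsTorsionPair T F) : ExtVanishes T F 0 :=
  fun X Y hX hY ↦ subsingleton_ext_zero (hTF.hom_eq_zero X Y hX hY)

theorem closedUnderSyzygies_of_extVanishes (hTF : IsTorsionPair T F) :
    ∀ {n : ℕ}, ExtVanishes T F n → ClosedUnderSyzygies T n
  | 0, _ => fun _ hX _ ↦ hX
  | n + 1, h => fun X hX Q ↦ hTF.mem_left fun Y hY f ↦ by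
    obtain ⟨i, p, hip, hp, hS, -⟩ := Q.exists_shortExact n
    -- Passing to the image makes the map surjective, which the superfluity argument requires.
    let Y' := FGModuleCat.of R (LinearMap.range f)
    have hY' : F Y' := hTF.mem_right_of_injective hY (LinearMap.range f).subtype
      (Submodule.injective_subtype _)
    obtain ⟨g, hg⟩ := exists_f_comp_eq_of_subsingleton_ext hS (Y := Y'.obj)
      (Q.subsingleton_ext_syzygy n (m := 0) (h X Y' hX hY')) (ModuleCat.ofHom f.rangeRestrict)
    have hgi : ∀ x, g.hom (i x) = f.rangeRestrict x := fun x ↦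
      LinearMap.congr_fun (congrArg ModuleCat.Hom.hom hg) x
    have hker : LinearMap.ker g.hom = ⊤ := hp.superfluous _ <| eq_top_iff.2 fun x _ ↦ by
      obtain ⟨y, hy⟩ := f.surjective_rangeRestrict (g.hom x)
      refine Submodule.mem_sup.2 ⟨x - i y, ?_, i y, (hip _).2 ⟨y, rfl⟩, sub_add_cancel _ _⟩
      rw [LinearMap.mem_ker, map_sub, hgi, hy, sub_self]
    ext x
    have := hgi x
    rw [LinearMap.ker_eq_top.1 hker] at this
    exact (congrArg Subtype.val this).symm

theorem closedUnderCosyzygies_of_extVanishes (hTF : IsTorsionPair T F) :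
    ∀ {n : ℕ}, ExtVanishes T F n → ClosedUnderCosyzygies F n
  | 0, _ => fun _ hY _ ↦ hY
  | n + 1, h => fun Y hY J ↦ hTF.mem_right fun X hX f ↦ by
    obtain ⟨i, p, hip, hi, hS, -⟩ := J.exists_shortExact n
    let X' := FGModuleCat.of R (LinearMap.range f)
    have hX' : T X' := hTF.mem_left_of_surjective hX f.rangeRestrict
      (LinearMap.surjective_rangeRestrict f)
    obtain ⟨g, hg⟩ := exists_comp_g_eq_of_subsingleton_ext hS (X := X'.obj)
      (J.subsingleton_ext_cosyzygy n (m := 0) (h X' Y hX' hY))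
      (ModuleCat.ofHom (LinearMap.range f).subtype)
    have hgp : ∀ x, p (g.hom x) = (LinearMap.range f).subtype x := fun x ↦
      LinearMap.congr_fun (congrArg ModuleCat.Hom.hom hg) x
    -- `p ∘ g` is the inclusion of the image of `f`, so the range of `g` meets `ker p = range i`
    -- trivially.
    have hrange : LinearMap.range g.hom = ⊥ := hi.essential _ <| eq_bot_iff.2 <| by
      rintro _ ⟨⟨x, rfl⟩, hx⟩
      have : (LinearMap.range f).subtype x = 0 := (hgp x).symm.trans ((hip _).2 hx)
      rw [show x = 0 from Subtype.ext this, map_zero]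
      exact Submodule.zero_mem _
    ext x
    have := hgp (f.rangeRestrict x)
    rw [LinearMap.range_eq_bot.1 hrange] at this
    exact this.symm.trans (map_zero p)

theorem extVanishes_mul_of_closedUnderSyzygies [IsArtinianRing R] (hTF : IsTorsionPair T F)
    {n : ℕ} (h : ClosedUnderSyzygies T n) (k : ℕ) : ExtVanishes T F (k * n) := by
  induction k with
  -- Starting at `k = 0`, where the claim is Hom-vanishing, avoids a separate argument for `k = 1`.
  | zero => rw [Nat.zero_mul]; exact hTF.extVanishes_zero
  | succ k ih =>
    intro X Y hX hY
    obtain ⟨Q⟩ := nonempty_minimalProjectiveResolution X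
    rw [Nat.succ_mul, Nat.add_comm]
    exact Q.subsingleton_ext_of_syzygy n (ih _ _ (h X hX Q) hY)

theorem extVanishes_of_closedUnderCosyzygies (K : Type w) [CommRing K] [IsArtinianRing K]
    [Algebra K R] [Module.Finite K R] (hTF : IsTorsionPair T F) {n : ℕ}
    (h : ClosedUnderCosyzygies F n) : ExtVanishes T F n := by
  intro X Y hX hY
  obtain ⟨J⟩ := nonempty_minimalInjectiveResolution K Y
  exact J.subsingleton_ext_of_cosyzygy n (m := 0) (hTF.extVanishes_zero _ _ hX (h Y hY J))

end IsTorsionPair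

end TorsionPair

end OmegaTorsion

/-- `A` is an artin algebra over the commutative artinian ring `K`, and `mod A`, the category of
finitely generated right `A`-modules, is `FGModuleCat Aᵐᵒᵖ`. -/
theorem mainTheorem4 {K : Type w} [CommRing K] [IsArtinianRing K]
    {A : Type u} [Ring A] [Algebra K A] [Module.Finite K A]
    (T F : ObjectProperty (FGModuleCat.{u} Aᵐᵒᵖ)) (hTF : OmegaTorsion.IsTorsionPair T F)
    (n : ℕ) :
    List.TFAE [
      ∀ k : ℕ, 1 ≤ k → OmegaTorsion.ExtVanishes T F (k * n),
      OmegaTorsion.ExtVanishes T F n,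
      OmegaTorsion.ClosedUnderSyzygies T n,
      OmegaTorsion.ClosedUnderCosyzygies F n] := by
  have : IsArtinianRing Aᵐᵒᵖ := IsArtinianRing.of_finite K Aᵐᵒᵖ
  tfae_have 1 → 2 := fun h ↦ by simpa using h 1 le_rfl
  tfae_have 2 → 3 := hTF.closedUnderSyzygies_of_extVanishes
  tfae_have 3 → 1 := fun h k _ ↦ hTF.extVanishes_mul_of_closedUnderSyzygies h k
  tfae_have 2 → 4 := hTF.closedUnderCosyzygies_of_extVanishes
  tfae_have 4 → 2 := hTF.extVanishes_of_closedUnderCosyzygies K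
  tfae_finish
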